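/- For real $\nu$ and $x>0$ let $J_\nu(x)=\sum_{k\ge 0}\frac{(-1)^k}{k!\,\Gamma(\nu+k+1)}(x/2)^{2k+\nu}$ be the Bessel function of the first kind, let $Y_\nu(x)=\frac{J_\nu(x)\cos(\nu\pi)-J_{-\nu}(x)}{\sin(\nu\pi)}$ (the limiting value in $\nu$ if $\nu$ is an integer) be the Bessel function of the second kind, and for fixed $\alpha\in[0,\pi)$ let $C_\nu=\cos\alpha\, J_\nu-\sin\alpha\, Y_\nu$. For an integer $n\ge 0$ and $\nu>0$ let $$R_{n,\nu}(x)=\sum_{k=0}^{\lfloor n/2\rfloor}(-1)^k\binom{n-k}{k}\frac{\Gamma(\nu+n-k)}{\Gamma(\nu+k)}\Big(\frac x2\Big)^{2k-n}$$ be the Lommel polynomial. Let $\nu>0$, let $m\ge 1$ be an integer and let $\alpha\in[0,\pi)$. Let $\mathcal M_{m,\nu}$ be the (possibly empty) set of common positive zeros of $C_\nu$ and $C_{\nu+m}$. Let $c_{\nu,k_1}<c_{\nu,k_2}<\cdots$ be the positive zeros of $C_\nu$ that do not belong to $\mathcal M_{m,\nu}$, and let $\tau_{m,\nu,1}<\tau_{m,\nu,2}<\cdots$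 be the elements of the union of the set of positive zeros of $C_{\nu+m}$ and the set of positive zeros of $R_{m-1,\nu+1}$ (each point listed once), both arranged in ascending order. Then both are infinite sequences, and $$0<c_{\nu,k_1}<\tau_{m,\nu,1}<c_{\nu,k_2}<\tau_{m,\nu,2}<\cdots .$$ -/

import Mathlib

open scoped Topology

/-- The Bessel function of the first kind `J_ν(x)`, for real `ν` and `x > 0`. At the poles of the
Gamma function `Real.Gamma` is `0`, so that `1 / Γ` has its usual value `0` there. -/
noncomputable def besselJ (ν x : ℝ) : ℝ :=
  ∑' k : ℕ, (-1 : ℝ) ^ k / ((k.factorial : ℝ) * Real.Gamma (ν + k + 1)) *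
    (x / 2) ^ (2 * (k : ℝ) + ν)

/-- The quotient `(J_ν(x) cos(νπ) - J_{-ν}(x)) / sin(νπ)`, meaningful for `ν` not an integer. -/
noncomputable def besselYQuotient (ν x : ℝ) : ℝ :=
  (besselJ ν x * Real.cos (ν * Real.pi) - besselJ (-ν) x) / Real.sin (ν * Real.pi)

/-- The Bessel function of the second kind `Y_ν(x)`, for real `ν` and `x > 0`: the quotient above
if `ν` is not an integer (that is, `sin(νπ) ≠ 0`), and its limit as `μ → ν`, `μ ≠ ν`, if `ν` is an
integer. -/
noncomputable def besselY (ν x : ℝ) : ℝ :=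
  if Real.sin (ν * Real.pi) = 0 then Filter.limUnder (𝓝[≠] ν) (fun μ : ℝ => besselYQuotient μ x)
  else besselYQuotient ν x

/-- The cylinder function `C_ν^α = cos α · J_ν - sin α · Y_ν`. -/
noncomputable def cylinderC (α ν x : ℝ) : ℝ :=
  Real.cos α * besselJ ν x - Real.sin α * besselY ν x

/-- The Lommel polynomial `R_{n,ν}(x)`, a polynomial in `1/x`, for `n = 0, 1, 2, …` and `ν > 0`. -/
noncomputable def lommelR (n : ℕ) (ν x : ℝ) : ℝ :=
  ∑ k ∈ Finset.range (n / 2 + 1), (-1 : ℝ) ^ k * ((n - k).choose k : ℝ) *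
    (Real.Gamma (ν + n - k) / Real.Gamma (ν + k)) * (x / 2) ^ (2 * (k : ℤ) - (n : ℤ))

/-- The set of positive zeros of a real function. -/
def posZeros (f : ℝ → ℝ) : Set ℝ := {x | 0 < x ∧ f x = 0}

/-- The set `M_{m,ν}` of the positive zeros of `C_ν` at which `C_{ν+m}` vanishes too. -/
def commonZeros (α : ℝ) (m : ℕ) (ν : ℝ) : Set ℝ :=
  {x | x ∈ posZeros (cylinderC α ν) ∧ cylinderC α (ν + m) x = 0}

/-- The sequence `a 0, a 1, a 2, …` lists all elements of `S`, each of them once, in ascending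
order. -/
def IsAscendingEnumeration (S : Set ℝ) (a : ℕ → ℝ) : Prop :=
  StrictMono a ∧ Set.range a = S

/-! Put f = R_{m-1,ν+1} · C_{ν+m} · C_ν. Its zeros are exactly the points to be interlaced, and f >
0 near 0, so it suffices that f changes sign downwards at the zeros of C_ν outside M_{m,ν}, upwards
at every zero of C_{ν+m} or R_{m-1,ν+1}, and that the former are unbounded
(`exists_interlacing_enumerations`).

The signs come from C_{ν+m} = R_{m-1,ν+1} C_{ν+1} - R_{m-2,ν+2} C_ν and its inverse C_ν =
R_{m-1,ν+1} C_{ν+m-1} - R_{m-2,ν+1} C_{ν+m}. They give f' = -C_{ν+m}² at a zero of C_ν alone, f' =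
C_ν² at a zero of C_{ν+m} alone, and f' = -R'_{m-1,ν+1} R_{m-2,ν+2} C_ν² > 0 at a zero of
R_{m-1,ν+1} alone, by `lommelShift_wronskian_neg`. Since C_ν and C_{ν+1} have no common zero, two
factors can vanish together only if all three do; f then has a triple zero, whose sign is found the
same way.

Unboundedness holds because C_ν oscillates (`exists_cylinderC_eq_zero`) while common zeros are zeros
of R_{m-1,ν+1}, which are finite in number. -/

/-! ### Bounds for the reciprocal Gamma function. -/

/-- The reciprocal `1 / Γ` of the Gamma function, an entire function. -/
noncomputable def recipGamma (s : ℝ) : ℝ := (Real.Gamma s)⁻¹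

lemma recipGamma_eq_re (s : ℝ) : recipGamma s = ((Complex.Gamma (s : ℂ))⁻¹).re := by
  rw [Complex.Gamma_ofReal, ← Complex.ofReal_inv, Complex.ofReal_re, recipGamma]

lemma contDiff_recipGamma : ContDiff ℝ 2 recipGamma := by
  have h : ContDiff ℂ 2 (fun s : ℂ => (Complex.Gamma s)⁻¹) :=
    Complex.differentiable_one_div_Gamma.contDiff
  have h2 := h.real_of_complex
  rwa [show recipGamma = fun s : ℝ => ((Complex.Gamma (s : ℂ))⁻¹).re from
    funext recipGamma_eq_re]

lemma hasDerivAt_recipGamma (s : ℝ) : HasDerivAt recipGamma (deriv recipGamma s) s :=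
  (contDiff_recipGamma.differentiable (by norm_num) s).hasDerivAt

lemma recipGamma_eq_mul (s : ℝ) : recipGamma s = s * recipGamma (s + 1) := by
  rcases eq_or_ne s 0 with rfl | hs
  · simp [recipGamma]
  · rw [recipGamma, recipGamma, Real.Gamma_add_one hs, mul_inv, ← mul_assoc,
      mul_inv_cancel₀ hs, one_mul]

lemma deriv_recipGamma_eq (s : ℝ) :
    deriv recipGamma s = recipGamma (s + 1) + s * deriv recipGamma (s + 1) := by
  have h1 : HasDerivAt (fun s : ℝ => s * recipGamma (s + 1))
      (1 * recipGamma (s + 1) + s * deriv recipGamma (s + 1)) s :=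
    (hasDerivAt_id s).mul ((hasDerivAt_recipGamma (s + 1)).comp_add_const s 1)
  rw [one_mul] at h1
  rw [show (fun s : ℝ => s * recipGamma (s + 1)) = recipGamma from
    funext fun s => (recipGamma_eq_mul s).symm] at h1
  exact h1.deriv

/-- `1 / Γ` and its derivative are bounded on every right half-line. -/
lemma exists_recipGamma_bound (M : ℝ) :
    ∃ B : ℝ, ∀ s, M ≤ s → |recipGamma s| ≤ B ∧ |deriv recipGamma s| ≤ B := by
  wlog hM : M ≤ 0 generalizing M
  · obtain ⟨B, hB⟩ := this 0 le_rfl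
    exact ⟨B, fun s hs => hB s ((not_le.1 hM).le.trans hs)⟩
  have hc1 : ContinuousOn recipGamma (Set.Icc M 3) :=
    contDiff_recipGamma.continuous.continuousOn
  have hc2 : ContinuousOn (deriv recipGamma) (Set.Icc M 3) :=
    (contDiff_recipGamma.continuous_deriv (by norm_num)).continuousOn
  obtain ⟨B1, hB1⟩ := isCompact_Icc.exists_bound_of_continuousOn hc1
  obtain ⟨B2, hB2⟩ := isCompact_Icc.exists_bound_of_continuousOn hc2
  -- Beyond 3 the functional equation divides by s - 1 > 2, so a bound B at s - 1 gives B/2 for the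
  -- function and (B + B/2)/2 ≤ B for its derivative at s.
  have key : ∀ n : ℕ, ∀ s, M ≤ s → s ≤ 3 + n →
      |recipGamma s| ≤ max B1 B2 ∧ |deriv recipGamma s| ≤ max B1 B2 := by
    intro n
    induction n with
    | zero =>
      intro s h1 h2
      have hs : s ∈ Set.Icc M 3 := ⟨h1, by simpa using h2⟩
      exact ⟨(hB1 s hs).trans (le_max_left _ _), (hB2 s hs).trans (le_max_right _ _)⟩
    | succ n ih =>
      intro s h1 h2
      rcases le_or_gt s (3 + n) with h3 | h3
      · exact ih s h1 h3
      · have hn : (0 : ℝ) ≤ n := n.cast_nonneg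
        push_cast at h2
        obtain ⟨h5, h6⟩ := ih (s - 1) (by linarith) (by linarith)
        have e1 := recipGamma_eq_mul (s - 1)
        have e2 := deriv_recipGamma_eq (s - 1)
        rw [sub_add_cancel] at e1 e2
        have h7 : |recipGamma s| * 2 ≤ max B1 B2 := by
          rw [e1, abs_mul, abs_of_pos (by linarith : (0 : ℝ) < s - 1)] at h5
          nlinarith [abs_nonneg (recipGamma s)]
        have h8 : |deriv recipGamma s| * 2 ≤ |deriv recipGamma (s - 1)| + |recipGamma s| := by
          have : (s - 1) * deriv recipGamma s
              = deriv recipGamma (s - 1) - recipGamma s := by linarith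
          have h9 := abs_sub (deriv recipGamma (s - 1)) (recipGamma s)
          rw [← this, abs_mul, abs_of_pos (by linarith : (0 : ℝ) < s - 1)] at h9
          nlinarith [abs_nonneg (deriv recipGamma s)]
        constructor <;> linarith [abs_nonneg (recipGamma s)]
  refine ⟨max B1 B2, fun s hs => ?_⟩
  obtain ⟨n, hn⟩ := exists_nat_ge s
  exact key n s hs (by linarith)

/-! ### The power series of J, differentiated in the argument and in the order. -/

/-- The series `∑ (-1)ᵏ aₖ tᵏ / k!`. -/
noncomputable def altExpSeries (a : ℕ → ℝ) (t : ℝ) : ℝ :=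
  ∑' k : ℕ, (-1 : ℝ) ^ k * a k * (t ^ k / k.factorial)

lemma summable_altExpSeries {a : ℕ → ℝ} {B : ℝ} (ha : ∀ k, |a k| ≤ B) (t : ℝ) :
    Summable fun k : ℕ => (-1 : ℝ) ^ k * a k * (t ^ k / k.factorial) := by
  refine Summable.of_norm_bounded ((Real.summable_pow_div_factorial |t|).mul_left B) fun k => ?_
  rw [norm_mul, norm_mul, norm_pow, norm_neg, norm_one, one_pow, one_mul, norm_div, norm_pow,
    Real.norm_eq_abs, Real.norm_eq_abs, Real.norm_natCast]
  exact mul_le_mul_of_nonneg_right (ha k) (by positivity)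

lemma hasDerivAt_altExpSeries {a : ℕ → ℝ} {B : ℝ} (ha : ∀ k, |a k| ≤ B) (t : ℝ) :
    HasDerivAt (altExpSeries a) (-altExpSeries (fun k => a (k + 1)) t) t := by
  -- Termwise differentiation needs a summable bound uniform near t; the ball of radius |t| + 1
  -- provides one.
  set R := |t| + 1
  have hR : 0 ≤ R := by positivity
  have hB : 0 ≤ B := (abs_nonneg _).trans (ha 0)
  have hfac : ∀ (k : ℕ) (y : ℝ),
      ((k + 1 : ℕ) : ℝ) * y ^ k / ((k + 1).factorial : ℝ) = y ^ k / k.factorial := by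
    intro k y
    rw [Nat.factorial_succ, Nat.cast_mul, mul_div_mul_left _ _ (by positivity)]
  have hu : Summable fun k : ℕ => B * ((k : ℝ) * R ^ (k - 1) / k.factorial) := by
    refine Summable.mul_left B ((summable_nat_add_iff 1).1 ?_)
    simp only [Nat.add_sub_cancel, hfac]
    exact Real.summable_pow_div_factorial R
  have hbound : ∀ (k : ℕ), ∀ y ∈ Metric.ball (0 : ℝ) R,
      ‖(-1 : ℝ) ^ k * a k * ((k : ℝ) * y ^ (k - 1) / k.factorial)‖
        ≤ B * ((k : ℝ) * R ^ (k - 1) / k.factorial) := by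
    intro k y hy
    rw [mem_ball_zero_iff] at hy
    rw [norm_mul, norm_mul, norm_pow, norm_neg, norm_one, one_pow, one_mul, norm_div, norm_mul,
      norm_pow, Real.norm_natCast, Real.norm_natCast]
    refine mul_le_mul (ha k) ?_ (by positivity) hB
    gcongr
  have ht : t ∈ Metric.ball (0 : ℝ) R := by
    rw [mem_ball_zero_iff, Real.norm_eq_abs]; exact lt_add_one _
  have hd := hasDerivAt_tsum_of_isPreconnected hu Metric.isOpen_ball
    (convex_ball (0 : ℝ) R).isPreconnected
    (fun k y _ => ((hasDerivAt_pow k y).div_const (k.factorial : ℝ)).const_mul ((-1 : ℝ) ^ k * a k))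
    hbound ht (summable_altExpSeries ha t) ht
  have hs : Summable fun k : ℕ => (-1 : ℝ) ^ k * a k * ((k : ℝ) * t ^ (k - 1) / k.factorial) :=
    Summable.of_norm_bounded hu fun k => hbound k t ht
  have e : ∑' k : ℕ, (-1 : ℝ) ^ k * a k * ((k : ℝ) * t ^ (k - 1) / k.factorial) =
      -altExpSeries (fun k => a (k + 1)) t := by
    rw [hs.tsum_eq_zero_add, altExpSeries, ← tsum_neg]
    simp only [Nat.add_sub_cancel, hfac, Nat.cast_zero, zero_mul, zero_div, mul_zero, zero_add]
    exact tsum_congr fun k => by ring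
  rw [e] at hd
  exact hd

/-- The entire factor of the Bessel function: `J_μ(x) = (x/2)^μ Φ(μ, (x/2)²)`. -/
noncomputable def besselPhi (μ t : ℝ) : ℝ :=
  altExpSeries (fun k => recipGamma (μ + k + 1)) t

/-- The derivative of `besselPhi` with respect to the order. -/
noncomputable def besselPhiOrder (μ t : ℝ) : ℝ :=
  altExpSeries (fun k => deriv recipGamma (μ + k + 1)) t

lemma exists_recipGamma_bound_nat (M : ℝ) :
    ∃ B : ℝ, ∀ μ, M ≤ μ → ∀ k : ℕ,
      |recipGamma (μ + k + 1)| ≤ B ∧ |deriv recipGamma (μ + k + 1)| ≤ B := by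
  obtain ⟨B, hB⟩ := exists_recipGamma_bound M
  exact ⟨B, fun μ hμ k => hB _ (by have : (0 : ℝ) ≤ k := k.cast_nonneg
                                   linarith)⟩

lemma hasDerivAt_besselPhi (μ t : ℝ) :
    HasDerivAt (besselPhi μ) (-besselPhi (μ + 1) t) t := by
  obtain ⟨B, hB⟩ := exists_recipGamma_bound_nat μ
  have h := hasDerivAt_altExpSeries (fun k => (hB μ le_rfl k).1) t
  have e : (fun k : ℕ => recipGamma (μ + (k + 1 : ℕ) + 1)) =
      fun k : ℕ => recipGamma (μ + 1 + k + 1) := by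
    ext k
    push_cast
    ring_nf
  rw [e] at h
  exact h

lemma hasDerivAt_besselPhiOrder (μ t : ℝ) :
    HasDerivAt (besselPhiOrder μ) (-besselPhiOrder (μ + 1) t) t := by
  obtain ⟨B, hB⟩ := exists_recipGamma_bound_nat μ
  have h := hasDerivAt_altExpSeries (fun k => (hB μ le_rfl k).2) t
  have e : (fun k : ℕ => deriv recipGamma (μ + (k + 1 : ℕ) + 1)) =
      fun k : ℕ => deriv recipGamma (μ + 1 + k + 1) := by
    ext k
    push_cast
    ring_nf
  rw [e] at h
  exact h

lemma hasDerivAt_besselPhi_order (μ t : ℝ) :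
    HasDerivAt (fun μ => besselPhi μ t) (besselPhiOrder μ t) μ := by
  obtain ⟨B, hB⟩ := exists_recipGamma_bound_nat (μ - 1)
  have hmem : μ ∈ Set.Ioi (μ - 1) := by simp
  refine hasDerivAt_tsum_of_isPreconnected (u := fun k : ℕ => B * (|t| ^ k / k.factorial))
    (g := fun (k : ℕ) μ => (-1 : ℝ) ^ k * recipGamma (μ + k + 1) * (t ^ k / k.factorial))
    (g' := fun (k : ℕ) μ => (-1 : ℝ) ^ k * deriv recipGamma (μ + k + 1) * (t ^ k / k.factorial))
    ((Real.summable_pow_div_factorial |t|).mul_left B) isOpen_Ioi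
    (convex_Ioi (μ - 1)).isPreconnected (fun k y _ => ?_) (fun k y hy => ?_) hmem
    (summable_altExpSeries (fun k => (hB μ (by linarith) k).1) t) hmem
  · have h := hasDerivAt_recipGamma (y + (k + 1))
    simpa only [add_assoc] using
      ((h.comp_add_const y (k + 1 : ℝ)).const_mul ((-1 : ℝ) ^ k)).mul_const (t ^ k / k.factorial)
  · rw [norm_mul, norm_mul, norm_pow, norm_neg, norm_one, one_pow, one_mul, norm_div, norm_pow,
      Real.norm_eq_abs, Real.norm_eq_abs, Real.norm_natCast]
    exact mul_le_mul_of_nonneg_right (hB y (le_of_lt hy) k).2 (by positivity)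

lemma besselPhi_zero (μ : ℝ) : besselPhi μ 0 = recipGamma (μ + 1) := by
  rw [besselPhi, altExpSeries, tsum_eq_single 0]
  · simp
  · intro k hk; simp [hk]

/-- Write 1/Γ(μ+k) = (μ+k)/Γ(μ+k+1); the factor k cancels into k! and shifts the index, producing
the second term. -/
lemma besselPhi_sub_one (μ t : ℝ) :
    besselPhi (μ - 1) t = μ * besselPhi μ t - t * besselPhi (μ + 1) t := by
  obtain ⟨B, hB⟩ := exists_recipGamma_bound_nat (μ - 1)
  have s0 := summable_altExpSeries (fun k => (hB (μ - 1) (by linarith) k).1) t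
  have s1 := summable_altExpSeries (fun k => (hB μ (by linarith) k).1) t
  have s2 := summable_altExpSeries (fun k => (hB (μ + 1) (by linarith) k).1) t
  simp only [besselPhi, altExpSeries]
  rw [s0.tsum_eq_zero_add, s1.tsum_eq_zero_add, mul_add, ← tsum_mul_left, ← tsum_mul_left,
    add_sub_assoc, ← ((((summable_nat_add_iff 1).2 s1).mul_left μ).tsum_sub (s2.mul_left t))]
  congr 1
  · have := recipGamma_eq_mul μ
    simp [this]
  · refine tsum_congr fun k => ?_
    have e := recipGamma_eq_mul (μ + k + 1)
    rw [Nat.factorial_succ, Nat.cast_mul]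
    push_cast
    rw [show μ - 1 + ((k : ℝ) + 1) + 1 = μ + k + 1 by ring,
      show μ + ((k : ℝ) + 1) + 1 = μ + k + 1 + 1 by ring,
      show μ + 1 + (k : ℝ) + 1 = μ + k + 1 + 1 by ring, e]
    field_simp
    ring

lemma besselJ_eq (ν : ℝ) {x : ℝ} (hx : 0 < x) :
    besselJ ν x = (x / 2) ^ ν * besselPhi ν ((x / 2) ^ 2) := by
  have hy : 0 < x / 2 := by positivity
  rw [besselJ, besselPhi, altExpSeries, ← tsum_mul_left]
  refine tsum_congr fun k => ?_
  rw [Real.rpow_add hy, Real.rpow_mul hy.le, Real.rpow_natCast,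
    show (x / 2) ^ (2 : ℝ) = (x / 2) ^ 2 from Real.rpow_natCast _ 2, recipGamma, div_eq_mul_inv,
    mul_inv]
  ring

/-! ### Recurrences, derivatives and the Wronskian for J. -/

/-- The derivative of `J_μ(x)` with respect to the order `μ`. -/
noncomputable def besselJOrder (μ x : ℝ) : ℝ :=
  (x / 2) ^ μ * (Real.log (x / 2) * besselPhi μ ((x / 2) ^ 2) + besselPhiOrder μ ((x / 2) ^ 2))

lemma hasDerivAt_besselJ_order (μ : ℝ) {x : ℝ} (hx : 0 < x) :
    HasDerivAt (fun μ => besselJ μ x) (besselJOrder μ x) μ := by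
  have hy : 0 < x / 2 := by positivity
  rw [show (fun μ => besselJ μ x) = fun μ => (x / 2) ^ μ * besselPhi μ ((x / 2) ^ 2) from
    funext fun μ => besselJ_eq μ hx]
  refine (((hasDerivAt_id μ).const_rpow hy).mul
    (hasDerivAt_besselPhi_order μ ((x / 2) ^ 2))).congr_deriv ?_
  simp only [besselJOrder, id]
  ring

lemma besselJ_sub_one_add (μ : ℝ) {x : ℝ} (hx : 0 < x) :
    besselJ (μ - 1) x + besselJ (μ + 1) x = 2 * μ / x * besselJ μ x := by
  have hy : 0 < x / 2 := by positivity
  rw [besselJ_eq _ hx, besselJ_eq _ hx, besselJ_eq _ hx, besselPhi_sub_one,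
    Real.rpow_sub_one hy.ne', Real.rpow_add_one hy.ne']
  field_simp
  ring

lemma besselJOrder_sub_one_add (μ : ℝ) {x : ℝ} (hx : 0 < x) :
    besselJOrder (μ - 1) x + besselJOrder (μ + 1) x =
      2 / x * besselJ μ x + 2 * μ / x * besselJOrder μ x := by
  have h1 : HasDerivAt (fun μ => besselJ (μ - 1) x + besselJ (μ + 1) x)
      (besselJOrder (μ - 1) x + besselJOrder (μ + 1) x) μ :=
    ((hasDerivAt_besselJ_order (μ - 1) hx).comp_sub_const μ 1).add
      ((hasDerivAt_besselJ_order (μ + 1) hx).comp_add_const μ 1)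
  have h2 : HasDerivAt (fun μ => 2 * μ / x * besselJ μ x)
      (2 * 1 / x * besselJ μ x + 2 * μ / x * besselJOrder μ x) μ :=
    (((hasDerivAt_id μ).const_mul 2).div_const x).mul (hasDerivAt_besselJ_order μ hx)
  rw [funext fun μ => besselJ_sub_one_add μ hx] at h1
  rw [h1.unique h2, mul_one]

lemma hasDerivAt_half_rpow (μ : ℝ) {x : ℝ} (hx : 0 < x) :
    HasDerivAt (fun x : ℝ => (x / 2) ^ μ) (μ / x * (x / 2) ^ μ) x := by
  have hy : 0 < x / 2 := by positivity
  refine (((hasDerivAt_id x).div_const 2).rpow_const (p := μ) (Or.inl hy.ne')).congr_deriv ?_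
  simp only [id]
  rw [Real.rpow_sub_one hy.ne']
  field_simp

lemma hasDerivAt_half_sq (x : ℝ) : HasDerivAt (fun x : ℝ => (x / 2) ^ 2) (x / 2) x := by
  refine (((hasDerivAt_id x).div_const 2).pow 2).congr_deriv ?_
  simp only [id]
  push_cast
  ring

lemma hasDerivAt_besselJ (μ : ℝ) {x : ℝ} (hx : 0 < x) :
    HasDerivAt (besselJ μ) (-besselJ (μ + 1) x + μ / x * besselJ μ x) x := by
  have hy : 0 < x / 2 := by positivity
  have h1 := (hasDerivAt_half_rpow μ hx).mul
    ((hasDerivAt_besselPhi μ ((x / 2) ^ 2)).comp x (hasDerivAt_half_sq x))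
  have h2 : besselJ μ =ᶠ[𝓝 x] fun x => (x / 2) ^ μ * besselPhi μ ((x / 2) ^ 2) := by
    filter_upwards [lt_mem_nhds hx] with z hz using besselJ_eq μ hz
  refine (h1.congr_of_eventuallyEq h2).congr_deriv ?_
  rw [besselJ_eq _ hx, besselJ_eq _ hx, Real.rpow_add_one hy.ne']
  simp only [Function.comp]
  ring

lemma hasDerivAt_besselJOrder (μ : ℝ) {x : ℝ} (hx : 0 < x) :
    HasDerivAt (besselJOrder μ)
      (-besselJOrder (μ + 1) x + μ / x * besselJOrder μ x + besselJ μ x / x) x := by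
  have hy : 0 < x / 2 := by positivity
  have hl : HasDerivAt (fun x : ℝ => Real.log (x / 2)) (1 / 2 / (x / 2)) x :=
    ((hasDerivAt_id x).div_const 2).log hy.ne'
  have h1 := (hasDerivAt_half_rpow μ hx).mul ((hl.mul
    ((hasDerivAt_besselPhi μ ((x / 2) ^ 2)).comp x (hasDerivAt_half_sq x))).add
    ((hasDerivAt_besselPhiOrder μ ((x / 2) ^ 2)).comp x (hasDerivAt_half_sq x)))
  refine h1.congr_deriv ?_
  rw [besselJOrder, besselJOrder, besselJ_eq _ hx, Real.rpow_add_one hy.ne']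
  simp only [Function.comp, Pi.add_apply, Pi.mul_apply]
  field_simp
  ring

lemma hasDerivAt_besselJ_neg (μ : ℝ) {x : ℝ} (hx : 0 < x) :
    HasDerivAt (besselJ (-μ)) (besselJ (-(μ + 1)) x + μ / x * besselJ (-μ) x) x := by
  refine (hasDerivAt_besselJ (-μ) hx).congr_deriv ?_
  have h := besselJ_sub_one_add (-μ) hx
  rw [show -(μ + 1) = -μ - 1 by ring]
  linear_combination -h

lemma hasDerivAt_besselJOrder_neg (μ : ℝ) {x : ℝ} (hx : 0 < x) :
    HasDerivAt (besselJOrder (-μ))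
      (besselJOrder (-(μ + 1)) x + μ / x * besselJOrder (-μ) x - besselJ (-μ) x / x) x := by
  refine (hasDerivAt_besselJOrder (-μ) hx).congr_deriv ?_
  have h := besselJOrder_sub_one_add (-μ) hx
  rw [show -(μ + 1) = -μ - 1 by ring]
  linear_combination -h

lemma recipGamma_mul_reflection (μ : ℝ) :
    recipGamma (μ + 1) * recipGamma (-μ) = -Real.sin (μ * Real.pi) / Real.pi := by
  have h := Real.Gamma_mul_Gamma_one_sub (-μ)
  rw [recipGamma, recipGamma, ← mul_inv, mul_comm (Real.Gamma (μ + 1)),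
    show μ + 1 = 1 - -μ by ring, h, inv_div,
    show Real.pi * -μ = -(μ * Real.pi) by ring, Real.sin_neg]

/-- The Wronskian identity for `J_μ` and `J_{-μ}`. -/
lemma besselJ_wronskian_neg (μ : ℝ) {x : ℝ} (hx : 0 < x) :
    besselJ (μ + 1) x * besselJ (-μ) x + besselJ μ x * besselJ (-(μ + 1)) x =
      -2 * Real.sin (μ * Real.pi) / (Real.pi * x) := by
  have hy : 0 < x / 2 := by positivity
  -- With t = (x/2)², ψ is x/2 times the left side. The powers of x/2 have cancelled, so ψ makes
  -- sense at t = 0, where Gamma reflection evaluates this constant.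
  let ψ : ℝ → ℝ := fun t =>
    t * (besselPhi (μ + 1) t * besselPhi (-μ) t) + besselPhi μ t * besselPhi (-μ - 1) t
  have hψ : ∀ t, HasDerivAt ψ 0 t := by
    intro t
    refine (((hasDerivAt_id t).mul ((hasDerivAt_besselPhi (μ + 1) t).mul
      (hasDerivAt_besselPhi (-μ) t))).add ((hasDerivAt_besselPhi μ t).mul
      (hasDerivAt_besselPhi (-μ - 1) t))).congr_deriv ?_
    have e1 := besselPhi_sub_one (μ + 1) t
    have e2 := besselPhi_sub_one (-μ) t
    rw [add_sub_cancel_right] at e1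
    simp only [id, sub_add_cancel, Pi.mul_apply]
    linear_combination (-besselPhi (-μ) t) * e1 - besselPhi (μ + 1) t * e2
  have hc := is_const_of_deriv_eq_zero (fun t => (hψ t).differentiableAt)
    (fun t => (hψ t).deriv) ((x / 2) ^ 2) 0
  simp only [ψ, zero_mul, zero_add, besselPhi_zero, sub_add_cancel,
    recipGamma_mul_reflection] at hc
  rw [show -(μ + 1) = -μ - 1 by ring, besselJ_eq _ hx, besselJ_eq _ hx, besselJ_eq _ hx,
    besselJ_eq _ hx, Real.rpow_sub_one hy.ne', Real.rpow_add_one hy.ne', Real.rpow_neg hy.le]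
  have hp : (x / 2) ^ μ ≠ 0 := (Real.rpow_pos_of_pos hy μ).ne'
  generalize (x / 2) ^ μ = p at hp ⊢
  have hx0 := hx.ne'
  have hpi := Real.pi_ne_zero
  generalize Real.sin (μ * Real.pi) = s at hc ⊢
  field_simp at hc ⊢
  linear_combination hc

/-! ### The function Y, with integer orders as a limit. -/

lemma besselJ_neg_natCast {x : ℝ} (hx : 0 < x) (n : ℕ) :
    besselJ (-(n : ℝ)) x = (-1) ^ n * besselJ n x := by
  induction n using Nat.twoStepInduction with
  | zero => simp
  | one =>
    have h := besselJ_sub_one_add 0 hx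
    norm_num at h ⊢
    linarith
  | more n h0 h1 =>
    have e1 := besselJ_sub_one_add (-((n : ℝ) + 1)) hx
    have e2 := besselJ_sub_one_add ((n : ℝ) + 1) hx
    push_cast at h1 ⊢
    rw [show -((n : ℝ) + 1) + 1 = -n by ring, h0, h1] at e1
    rw [add_sub_cancel_right, show (n : ℝ) + 1 + 1 = n + 2 by ring] at e2
    rw [show -((n : ℝ) + 2) = -((n : ℝ) + 1) - 1 by ring, pow_succ, pow_succ]
    rw [pow_succ] at e1
    linear_combination e1 - (-1) ^ n * e2

lemma besselJ_neg_of_sin_eq_zero {ν x : ℝ} (hν : 0 ≤ ν) (hs : Real.sin (ν * Real.pi) = 0)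
    (hx : 0 < x) : besselJ (-ν) x = Real.cos (ν * Real.pi) * besselJ ν x := by
  obtain ⟨k, hk⟩ := Real.sin_eq_zero_iff.1 hs
  have hk' : (k : ℝ) = ν := mul_right_cancel₀ Real.pi_ne_zero hk
  obtain ⟨n, rfl⟩ : ∃ n : ℕ, k = n := by
    refine Int.eq_ofNat_of_zero_le ?_
    rw [← hk'] at hν
    exact_mod_cast hν
  rw [← hk', Int.cast_natCast, besselJ_neg_natCast hx, Real.cos_nat_mul_pi]

lemma cos_sq_of_sin_eq_zero {θ : ℝ} (hs : Real.sin θ = 0) : Real.cos θ * Real.cos θ = 1 := by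
  have := Real.sin_sq_add_cos_sq θ
  rw [hs] at this
  linarith

lemma sin_add_one_mul_pi (ν : ℝ) :
    Real.sin ((ν + 1) * Real.pi) = -Real.sin (ν * Real.pi) := by
  rw [add_mul, one_mul, Real.sin_add_pi]

lemma cos_add_one_mul_pi (ν : ℝ) :
    Real.cos ((ν + 1) * Real.pi) = -Real.cos (ν * Real.pi) := by
  rw [add_mul, one_mul, Real.cos_add_pi]

lemma tendsto_div_of_hasDerivAt {f g : ℝ → ℝ} {f' g' a : ℝ} (hf : HasDerivAt f f' a)
    (hg : HasDerivAt g g' a) (hfa : f a = 0) (hga : g a = 0) (hg' : g' ≠ 0) :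
    Filter.Tendsto (fun x => f x / g x) (𝓝[≠] a) (𝓝 (f' / g')) := by
  refine Filter.Tendsto.congr' ?_
    ((hasDerivAt_iff_tendsto_slope.1 hf).div (hasDerivAt_iff_tendsto_slope.1 hg) hg')
  filter_upwards [self_mem_nhdsWithin] with x hx
  have hx' : x - a ≠ 0 := sub_ne_zero.2 hx
  simp only [Pi.div_apply, slope_def_field, hfa, hga, sub_zero]
  rw [div_div_div_cancel_right₀ hx']

/-- At nonnegative integer order, `Y_ν` is given by the derivatives of `J` in the order. -/
lemma besselY_of_sin_eq_zero {ν x : ℝ} (hν : 0 ≤ ν) (hs : Real.sin (ν * Real.pi) = 0)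
    (hx : 0 < x) :
    besselY ν x =
      (besselJOrder ν x + Real.cos (ν * Real.pi) * besselJOrder (-ν) x) / Real.pi := by
  have hε := cos_sq_of_sin_eq_zero hs
  have hε0 : Real.cos (ν * Real.pi) ≠ 0 := fun h => by simp [h] at hε
  have hl : HasDerivAt (fun μ : ℝ => μ * Real.pi) (1 * Real.pi) ν :=
    (hasDerivAt_id ν).mul_const Real.pi
  have hN := ((hasDerivAt_besselJ_order ν hx).mul hl.cos).sub
    (HasDerivAt.scomp ν (hasDerivAt_besselJ_order (-ν) hx) (hasDerivAt_neg ν))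
  -- L'Hôpital in the order: the numerator vanishes because J_{-ν} = cos(νπ) J_ν at integer ν ≥ 0.
  have ht := tendsto_div_of_hasDerivAt hN hl.sin
    (by
      simp only [Pi.sub_apply, Pi.mul_apply, Function.comp]
      rw [besselJ_neg_of_sin_eq_zero hν hs hx]
      ring) hs (by simpa using hε0)
  rw [besselY, if_pos hs]
  refine (Filter.Tendsto.limUnder_eq ht).trans ?_
  have hpi := Real.pi_ne_zero
  rw [hs, smul_eq_mul, div_eq_div_iff (by simpa using hε0) hpi]
  linear_combination (-Real.pi * besselJOrder (-ν) x) * hε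

lemma besselY_of_sin_ne_zero {ν : ℝ} (hs : Real.sin (ν * Real.pi) ≠ 0) (x : ℝ) :
    besselY ν x = (besselJ ν x * Real.cos (ν * Real.pi) - besselJ (-ν) x) /
      Real.sin (ν * Real.pi) := by
  rw [besselY, if_neg hs, besselYQuotient]

/-- At integer order, the extra terms ±J/x in the derivatives of `besselJOrder` cancel, since J_{-ν}
= cos(νπ) J_ν and cos²(νπ) = 1. -/
lemma hasDerivAt_besselY {ν x : ℝ} (hν : 0 ≤ ν) (hx : 0 < x) :
    HasDerivAt (besselY ν) (-besselY (ν + 1) x + ν / x * besselY ν x) x := by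
  by_cases hs : Real.sin (ν * Real.pi) = 0
  · have hs' : Real.sin ((ν + 1) * Real.pi) = 0 := by rw [sin_add_one_mul_pi, hs, neg_zero]
    have h1 := ((hasDerivAt_besselJOrder ν hx).add
      ((hasDerivAt_besselJOrder_neg ν hx).const_mul (Real.cos (ν * Real.pi)))).div_const Real.pi
    have h2 : besselY ν =ᶠ[𝓝 x] fun z =>
        (besselJOrder ν z + Real.cos (ν * Real.pi) * besselJOrder (-ν) z) / Real.pi := by
      filter_upwards [lt_mem_nhds hx] with z hz using besselY_of_sin_eq_zero hν hs hz
    refine (h1.congr_of_eventuallyEq h2).congr_deriv ?_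
    rw [besselY_of_sin_eq_zero hν hs hx, besselY_of_sin_eq_zero (by linarith) hs' hx,
      cos_add_one_mul_pi, besselJ_neg_of_sin_eq_zero hν hs hx]
    have hε := cos_sq_of_sin_eq_zero hs
    linear_combination (-besselJ ν x / x / Real.pi) * hε
  · have hs' : Real.sin ((ν + 1) * Real.pi) ≠ 0 := by
      rw [sin_add_one_mul_pi]; exact neg_ne_zero.2 hs
    have h1 := (((hasDerivAt_besselJ ν hx).mul_const (Real.cos (ν * Real.pi))).sub
      (hasDerivAt_besselJ_neg ν hx)).div_const (Real.sin (ν * Real.pi))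
    rw [show besselY ν = _ from funext (besselY_of_sin_ne_zero hs)]
    refine h1.congr_deriv ?_
    rw [besselY_of_sin_ne_zero hs', cos_add_one_mul_pi, sin_add_one_mul_pi]
    field_simp
    ring

lemma besselY_add_two {ν x : ℝ} (hν : 0 ≤ ν) (hx : 0 < x) :
    besselY ν x + besselY (ν + 2) x = 2 * (ν + 1) / x * besselY (ν + 1) x := by
  have e : ν + 2 = ν + 1 + 1 := by ring
  have a1 := besselJ_sub_one_add (ν + 1) hx
  have a2 := besselJ_sub_one_add (-(ν + 1)) hx
  have b1 := besselJOrder_sub_one_add (ν + 1) hx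
  have b2 := besselJOrder_sub_one_add (-(ν + 1)) hx
  rw [add_sub_cancel_right, ← e] at a1 b1
  rw [show -(ν + 1) + 1 = -ν by ring, show -(ν + 1) - 1 = -(ν + 2) by ring] at a2 b2
  by_cases hs : Real.sin (ν * Real.pi) = 0
  · have hs' : Real.sin ((ν + 1) * Real.pi) = 0 := by rw [sin_add_one_mul_pi, hs, neg_zero]
    have hs'' : Real.sin ((ν + 2) * Real.pi) = 0 := by rw [e, sin_add_one_mul_pi, hs', neg_zero]
    have hn := besselJ_neg_of_sin_eq_zero (by linarith) hs' hx
    rw [hn] at b2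
    rw [besselY_of_sin_eq_zero hν hs hx, besselY_of_sin_eq_zero (by linarith) hs' hx,
      besselY_of_sin_eq_zero (by linarith) hs'' hx, e, cos_add_one_mul_pi (ν + 1), ← e]
    rw [cos_add_one_mul_pi] at b2 ⊢
    have hε := cos_sq_of_sin_eq_zero hs
    linear_combination (1 / Real.pi) * b1 + (Real.cos (ν * Real.pi) / Real.pi) * b2 -
      (2 / x * besselJ (ν + 1) x / Real.pi) * hε
  · have hs' : Real.sin ((ν + 1) * Real.pi) ≠ 0 := by
      rw [sin_add_one_mul_pi]; exact neg_ne_zero.2 hs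
    have hs'' : Real.sin ((ν + 2) * Real.pi) ≠ 0 := by
      rw [e, sin_add_one_mul_pi]; exact neg_ne_zero.2 hs'
    rw [besselY_of_sin_ne_zero hs, besselY_of_sin_ne_zero hs', besselY_of_sin_ne_zero hs'', e,
      cos_add_one_mul_pi (ν + 1), sin_add_one_mul_pi (ν + 1), ← e, cos_add_one_mul_pi,
      sin_add_one_mul_pi]
    generalize Real.sin (ν * Real.pi) = s at hs ⊢
    generalize Real.cos (ν * Real.pi) = c
    have hx0 := hx.ne'
    field_simp at a1 a2 ⊢
    linear_combination c * a1 - a2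

/-- The Wronskian identity for `J_ν` and `Y_ν`. -/
lemma besselJ_mul_besselY_sub {ν x : ℝ} (hν : 0 ≤ ν) (hx : 0 < x) :
    besselJ (ν + 1) x * besselY ν x - besselJ ν x * besselY (ν + 1) x =
      2 / (Real.pi * x) := by
  have hpi := Real.pi_ne_zero
  have hx0 := hx.ne'
  by_cases hs : Real.sin (ν * Real.pi) = 0
  · have hs' : Real.sin ((ν + 1) * Real.pi) = 0 := by rw [sin_add_one_mul_pi, hs, neg_zero]
    have hl : HasDerivAt (fun μ : ℝ => μ * Real.pi) (1 * Real.pi) ν :=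
      (hasDerivAt_id ν).mul_const Real.pi
    have hneg : ∀ μ : ℝ, HasDerivAt (fun μ => besselJ (-μ) x) (-besselJOrder (-μ) x) μ := by
      intro μ
      refine (HasDerivAt.scomp μ (hasDerivAt_besselJ_order (-μ) hx) (hasDerivAt_neg μ)).congr_deriv ?_
      rw [smul_eq_mul, neg_one_mul]
    -- At integer order the J-Wronskian is 0 = 0, so it is differentiated in the order instead of
    -- being divided by sin(νπ).
    have h1 := (((hasDerivAt_besselJ_order (ν + 1) hx).comp_add_const ν 1).mul (hneg ν)).add
      ((hasDerivAt_besselJ_order ν hx).mul ((hneg (ν + 1)).comp_add_const ν 1))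
    have h2 := (hl.sin.const_mul (-2)).div_const (Real.pi * x)
    have h3 := h1.unique (h2.congr_of_eventuallyEq (Filter.Eventually.of_forall fun μ =>
      besselJ_wronskian_neg μ hx))
    have hε := cos_sq_of_sin_eq_zero hs
    have n0 := besselJ_neg_of_sin_eq_zero hν hs hx
    have n1 := besselJ_neg_of_sin_eq_zero (by linarith) hs' hx
    rw [cos_add_one_mul_pi] at n1
    rw [besselY_of_sin_eq_zero hν hs hx, besselY_of_sin_eq_zero (by linarith) hs' hx,
      cos_add_one_mul_pi]
    rw [n0, n1] at h3
    generalize Real.cos (ν * Real.pi) = c at *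
    field_simp at h3 ⊢
    linear_combination (-c) * h3 +
      (2 - x * (besselJ (ν + 1) x * besselJOrder ν x - besselJ ν x * besselJOrder (ν + 1) x)) * hε
  · have hs' : Real.sin ((ν + 1) * Real.pi) ≠ 0 := by
      rw [sin_add_one_mul_pi]; exact neg_ne_zero.2 hs
    have hw := besselJ_wronskian_neg ν hx
    rw [besselY_of_sin_ne_zero hs, besselY_of_sin_ne_zero hs', cos_add_one_mul_pi,
      sin_add_one_mul_pi]
    generalize Real.sin (ν * Real.pi) = s at *
    generalize Real.cos (ν * Real.pi) = c at *
    field_simp at hw ⊢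
    linear_combination -hw

/-! ### Cylinder functions: recurrences, behaviour at 0, oscillation. -/

section Cylinder

variable {α ν x : ℝ}

lemma hasDerivAt_cylinderC (hν : 0 ≤ ν) (hx : 0 < x) :
    HasDerivAt (cylinderC α ν) (-cylinderC α (ν + 1) x + ν / x * cylinderC α ν x) x := by
  refine (((hasDerivAt_besselJ ν hx).const_mul (Real.cos α)).sub
    ((hasDerivAt_besselY hν hx).const_mul (Real.sin α))).congr_deriv ?_
  rw [cylinderC, cylinderC]
  ring

lemma cylinderC_add_two (hν : 0 ≤ ν) (hx : 0 < x) :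
    cylinderC α ν x + cylinderC α (ν + 2) x = 2 * (ν + 1) / x * cylinderC α (ν + 1) x := by
  have h1 := besselJ_sub_one_add (ν + 1) hx
  have h2 := besselY_add_two hν hx
  rw [add_sub_cancel_right, show ν + 1 + 1 = ν + 2 by ring] at h1
  rw [cylinderC, cylinderC, cylinderC]
  linear_combination Real.cos α * h1 - Real.sin α * h2

lemma hasDerivAt_cylinderC_add_one (hν : 0 ≤ ν) (hx : 0 < x) :
    HasDerivAt (cylinderC α (ν + 1)) (cylinderC α ν x - (ν + 1) / x * cylinderC α (ν + 1) x) x := by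
  refine (hasDerivAt_cylinderC (by linarith) hx).congr_deriv ?_
  have h := cylinderC_add_two (α := α) hν hx
  rw [show ν + 1 + 1 = ν + 2 by ring]
  linear_combination -h

/-- Otherwise the nonzero vector (cos α, -sin α) would be in the kernel of a matrix whose
determinant is, up to sign, the nonvanishing Wronskian of J and Y. -/
lemma cylinderC_add_one_ne_zero (hν : 0 ≤ ν) (hx : 0 < x) (h : cylinderC α ν x = 0) :
    cylinderC α (ν + 1) x ≠ 0 := by
  intro h1
  have hW := besselJ_mul_besselY_sub hν hx
  have hW0 : besselJ (ν + 1) x * besselY ν x - besselJ ν x * besselY (ν + 1) x ≠ 0 := by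
    rw [hW]
    have := Real.pi_pos
    positivity
  rw [cylinderC] at h h1
  apply hW0
  linear_combination (Real.cos α * besselY ν x + Real.sin α * besselJ ν x) * h1 -
    (Real.cos α * besselY (ν + 1) x + Real.sin α * besselJ (ν + 1) x) * h -
    (besselJ (ν + 1) x * besselY ν x - besselJ ν x * besselY (ν + 1) x) *
      Real.sin_sq_add_cos_sq α

lemma eventually_besselJ_mem_Ioo (hν : 0 < ν) :
    ∀ᶠ x in 𝓝[>] (0 : ℝ), besselJ ν x ∈ Set.Ioo 0 1 := by
  have hsq : Filter.Tendsto (fun x : ℝ => besselPhi ν ((x / 2) ^ 2)) (𝓝[>] 0)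
      (𝓝 (recipGamma (ν + 1))) := by
    have hc : Continuous (fun x : ℝ => besselPhi ν ((x / 2) ^ 2)) :=
      (continuous_iff_continuousAt.2 fun t => (hasDerivAt_besselPhi ν t).continuousAt).comp
        (by fun_prop)
    have := hc.tendsto 0
    rw [zero_div, zero_pow two_ne_zero, besselPhi_zero] at this
    exact this.mono_left nhdsWithin_le_nhds
  have hp : Filter.Tendsto (fun x : ℝ => (x / 2) ^ ν) (𝓝[>] 0) (𝓝 0) := by
    have hc : Continuous (fun x : ℝ => (x / 2) ^ ν) :=
      (Real.continuous_rpow_const hν.le).comp (by fun_prop)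
    have := hc.tendsto 0
    rw [zero_div, Real.zero_rpow hν.ne'] at this
    exact this.mono_left nhdsWithin_le_nhds
  have hg : 0 < recipGamma (ν + 1) := inv_pos.2 (Real.Gamma_pos_of_pos (by linarith))
  have hlim := hp.mul hsq
  rw [zero_mul] at hlim
  filter_upwards [hsq.eventually (lt_mem_nhds hg), hlim.eventually (gt_mem_nhds one_pos),
    self_mem_nhdsWithin] with x h1 h2 hx
  rw [Set.mem_Ioi] at hx
  rw [besselJ_eq ν hx]
  exact ⟨by positivity, h2⟩

/-- `Y_ν / J_ν` tends to `-∞` at `0`. -/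
lemma tendsto_besselY_div_besselJ (hν : 0 < ν) :
    Filter.Tendsto (fun x => besselY ν x / besselJ ν x) (𝓝[>] 0) Filter.atBot := by
  obtain ⟨δ, hδ, hJ⟩ := mem_nhdsGT_iff_exists_Ioo_subset.1 (eventually_besselJ_mem_Ioo hν)
  rw [Set.mem_Ioi] at hδ
  have hpi := Real.pi_pos
  -- By the Wronskian (Y/J)' = 2/(πxJ²), which is at least 2/(πx) while 0 < J < 1; hence Y/J lies
  -- below (2/π) log x plus a constant near 0.
  have hd : ∀ x ∈ Set.Ioo 0 δ,
      HasDerivAt (fun x => besselY ν x / besselJ ν x - 2 / Real.pi * Real.log x)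
        (2 / (Real.pi * x) / besselJ ν x ^ 2 - 2 / Real.pi * x⁻¹) x := by
    intro x hx
    have hJx : besselJ ν x ∈ Set.Ioo 0 1 := hJ hx
    refine (((hasDerivAt_besselY hν.le hx.1).div (hasDerivAt_besselJ ν hx.1) hJx.1.ne').sub
      ((Real.hasDerivAt_log hx.1.ne').const_mul (2 / Real.pi))).congr_deriv ?_
    rw [← besselJ_mul_besselY_sub hν.le hx.1]
    ring
  have hmono : MonotoneOn (fun x => besselY ν x / besselJ ν x - 2 / Real.pi * Real.log x)
      (Set.Ioo 0 δ) := by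
    refine monotoneOn_of_deriv_nonneg (convex_Ioo 0 δ)
      (fun x hx => (hd x hx).continuousAt.continuousWithinAt)
      (fun x hx => (hd x (interior_subset hx)).differentiableAt.differentiableWithinAt)
      (fun x hx => ?_)
    have hx' := interior_subset hx
    have hJx : besselJ ν x ∈ Set.Ioo 0 1 := hJ hx'
    have hx0 : 0 < x := hx'.1
    rw [(hd x hx').deriv, sub_nonneg, ← div_eq_mul_inv, div_div,
      le_div_iff₀ (pow_pos hJx.1 2)]
    exact mul_le_of_le_one_right (by positivity) (pow_le_one₀ hJx.1.le hJx.2.le)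
  have hlog : Filter.Tendsto (fun x => 2 / Real.pi * Real.log x +
      (besselY ν (δ / 2) / besselJ ν (δ / 2) - 2 / Real.pi * Real.log (δ / 2)))
      (𝓝[>] 0) Filter.atBot :=
    Filter.tendsto_atBot_add_const_right _ _
      (Real.tendsto_log_nhdsGT_zero.const_mul_atBot (by positivity))
  refine Filter.tendsto_atBot_mono' _ ?_ hlog
  filter_upwards [Ioo_mem_nhdsGT (half_pos hδ)] with x hx
  have := hmono ⟨hx.1, by linarith [hx.2]⟩ (⟨by linarith, by linarith⟩ : δ / 2 ∈ Set.Ioo 0 δ) hx.2.le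
  simp only at this
  linarith

/-- For α in (0, π) one has sin α > 0, and C = J (cos α - sin α · Y/J) with Y/J → -∞; for α = 0 it
is J itself. -/
lemma eventually_cylinderC_pos (hα₀ : 0 ≤ α) (hα₁ : α < Real.pi) (hν : 0 < ν) :
    ∀ᶠ x in 𝓝[>] (0 : ℝ), 0 < cylinderC α ν x := by
  rcases hα₀.eq_or_lt with rfl | hα
  · filter_upwards [eventually_besselJ_mem_Ioo hν] with x hx
    simpa [cylinderC] using hx.1
  · have hs := Real.sin_pos_of_pos_of_lt_pi hα hα₁
    filter_upwards [eventually_besselJ_mem_Ioo hν, (tendsto_besselY_div_besselJ hν).eventually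
      (Filter.eventually_lt_atBot (Real.cos α / Real.sin α))] with x hx hq
    rw [div_lt_div_iff₀ hx.1 hs] at hq
    rw [cylinderC]
    linarith

/-- A Prüfer angle argument: without zeros, r = C_{ν+1}/C_ν satisfies r' = 1 + r² - (2ν+1)r/x, so
arctan r grows at rate at least 1/2 once x ≥ 2ν+1. Over a length 2π it would gain π, the full width
of its open range. -/
lemma exists_cylinderC_eq_zero (hν : 0 ≤ ν) (T : ℝ) : ∃ x, T < x ∧ 0 < x ∧ cylinderC α ν x = 0 := by
  by_contra! hne
  obtain ⟨a, hTa, ha⟩ : ∃ a, T < a ∧ 2 * ν + 1 ≤ a :=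
    ⟨max (T + 1) (2 * ν + 1), lt_max_of_lt_left (lt_add_one T), le_max_right _ _⟩
  have hd : ∀ x, a ≤ x → HasDerivAt
      (fun x => Real.arctan (cylinderC α (ν + 1) x / cylinderC α ν x) - x / 2)
      ((1 + (cylinderC α (ν + 1) x / cylinderC α ν x) ^ 2)⁻¹ *
        (1 + (cylinderC α (ν + 1) x / cylinderC α ν x) ^ 2 -
          (2 * ν + 1) / x * (cylinderC α (ν + 1) x / cylinderC α ν x)) - 1 / 2) x := by
    intro x hx
    have hx0 : 0 < x := by linarith
    have hC := hne x (by linarith) hx0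
    refine (((hasDerivAt_cylinderC_add_one hν hx0).div
      (hasDerivAt_cylinderC hν hx0) hC).arctan.sub
      ((hasDerivAt_id x).div_const 2)).congr_deriv ?_
    rw [one_div]
    congr 2
    field_simp
    ring
  have hmono : MonotoneOn
      (fun x => Real.arctan (cylinderC α (ν + 1) x / cylinderC α ν x) - x / 2) (Set.Ici a) := by
    refine monotoneOn_of_deriv_nonneg (convex_Ici a)
      (fun x hx => (hd x hx).continuousAt.continuousWithinAt)
      (fun x hx => (hd x (interior_subset hx)).differentiableAt.differentiableWithinAt)
      (fun x hx => ?_)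
    have hx' : a ≤ x := interior_subset hx
    have hx0 : 0 < x := by linarith
    rw [(hd x hx').deriv]
    generalize cylinderC α (ν + 1) x / cylinderC α ν x = r
    have hq0 : 0 ≤ (2 * ν + 1) / x := by positivity
    have hq1 : (2 * ν + 1) / x ≤ 1 := (div_le_one hx0).2 (by linarith)
    generalize (2 * ν + 1) / x = q at hq0 hq1
    rw [sub_nonneg, inv_mul_eq_div, div_le_div_iff₀ two_pos (by positivity)]
    nlinarith [sq_nonneg (r - 1), sq_nonneg r]
  have hpi := Real.pi_pos
  have h := hmono (Set.mem_Ici.2 le_rfl) (Set.mem_Ici.2 (by linarith : a ≤ a + 2 * Real.pi))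
    (by linarith)
  simp only at h
  have h1 := Real.arctan_lt_pi_div_two
    (cylinderC α (ν + 1) (a + 2 * Real.pi) / cylinderC α ν (a + 2 * Real.pi))
  have h2 := Real.neg_pi_div_two_lt_arctan (cylinderC α (ν + 1) a / cylinderC α ν a)
  linarith

end Cylinder

/-! ### Lommel polynomials: recurrence, determinant, Wronskian. -/

/-- The Lommel polynomials with index shifted by one, `lommelShift (n + 1) ν = R_{n,ν}`,
defined by their recurrence, starting from `R_{-1,ν} = 0`. -/
noncomputable def lommelShift : ℕ → ℝ → ℝ → ℝ
  | 0, _, _ => 0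
  | 1, _, _ => 1
  | n + 2, ν, x => 2 * ν / x * lommelShift (n + 1) (ν + 1) x - lommelShift n (ν + 2) x

lemma lommelShift_add_two (n : ℕ) (ν x : ℝ) : lommelShift (n + 2) ν x =
    2 * ν / x * lommelShift (n + 1) (ν + 1) x - lommelShift n (ν + 2) x := rfl

/-- The added terms have a vanishing binomial coefficient, so sums of different lengths can be
aligned. -/
lemma lommelR_eq_sum_range {n N : ℕ} (hN : n / 2 + 1 ≤ N) (ν x : ℝ) :
    lommelR n ν x = ∑ k ∈ Finset.range N, (-1 : ℝ) ^ k * ((n - k).choose k : ℝ) *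
      (Real.Gamma (ν + n - k) / Real.Gamma (ν + k)) * (x / 2) ^ (2 * (k : ℤ) - (n : ℤ)) := by
  refine Finset.sum_subset (Finset.range_mono hN) fun k _ hk => ?_
  rw [Finset.mem_range, not_lt] at hk
  rw [Nat.choose_eq_zero_of_lt (by omega)]
  simp

lemma lommelR_add_two (n : ℕ) {ν x : ℝ} (hν : 0 < ν) (hx : 0 < x) :
    lommelR (n + 2) ν x = 2 * ν / x * lommelR (n + 1) (ν + 1) x - lommelR n (ν + 2) x := by
  rw [lommelR_eq_sum_range (N := n + 3) (by omega), lommelR_eq_sum_range (N := n + 3) (by omega),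
    lommelR_eq_sum_range (n := n) (N := n + 2) (by omega), Finset.sum_range_succ',
    Finset.sum_range_succ' _ (n + 2), mul_add, Finset.mul_sum, add_sub_right_comm (∑ i ∈ Finset.range (n + 2), _),
    ← Finset.sum_sub_distrib]
  have hy : x / 2 ≠ 0 := by positivity
  have hΓ : Real.Gamma (ν + 1) = ν * Real.Gamma ν := Real.Gamma_add_one hν.ne'
  have hΓ0 : Real.Gamma ν ≠ 0 := (Real.Gamma_pos_of_pos hν).ne'
  congr 1
  · refine Finset.sum_congr rfl fun k hk => ?_
    rw [Finset.mem_range] at hk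
    have hk0 : (0 : ℝ) ≤ k := k.cast_nonneg
    have hG : Real.Gamma (ν + k + 2) = (ν + k + 1) * Real.Gamma (ν + k + 1) := by
      rw [← Real.Gamma_add_one (by linarith)]; ring_nf
    have hG0 : Real.Gamma (ν + k + 1) ≠ 0 := (Real.Gamma_pos_of_pos (by linarith)).ne'
    have hkn : (ν + k + 1 : ℝ) ≠ 0 := by linarith
    have hZ : (x / 2) ^ (2 * (k : ℤ) - n) ≠ 0 := zpow_ne_zero _ hy
    have hz : (x / 2) ^ (2 * ((k + 1 : ℕ) : ℤ) - ((n + 1 : ℕ) : ℤ)) =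
        (x / 2) ^ (2 * (k : ℤ) - n) * (x / 2) := by
      rw [← zpow_add_one₀ hy]; push_cast; ring_nf
    have hz2 : (x / 2) ^ (2 * ((k + 1 : ℕ) : ℤ) - ((n + 2 : ℕ) : ℤ)) =
        (x / 2) ^ (2 * (k : ℤ) - n) := by
      push_cast; ring_nf
    have e1 : ν + ((n + 2 : ℕ) : ℝ) - ((k + 1 : ℕ) : ℝ) = ν + 1 + n - k := by push_cast; ring
    have e2 : ν + 1 + ((n + 1 : ℕ) : ℝ) - ((k + 1 : ℕ) : ℝ) = ν + 1 + n - k := by push_cast; ring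
    have e3 : ν + 2 + (n : ℝ) - k = (ν + 1 + n - k) + 1 := by ring
    have e4 : ν + ((k + 1 : ℕ) : ℝ) = ν + k + 1 := by push_cast; ring
    have e5 : ν + 1 + ((k + 1 : ℕ) : ℝ) = ν + k + 2 := by push_cast; ring
    have e6 : ν + 2 + (k : ℝ) = ν + k + 2 := by ring
    have hkn' : (k : ℝ) ≤ n + 1 := by
      have : k ≤ n + 1 := by omega
      exact_mod_cast this
    have hq : ν + 1 + n - k ≠ 0 := by linarith
    rw [hz, hz2, e1, e2, e3, e4, e5, e6, Real.Gamma_add_one hq, hG, pow_succ]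
    have c1 : n + 2 - (k + 1) = n + 1 - k := by omega
    have c2 : n + 1 - (k + 1) = n - k := by omega
    rw [c1, c2]
    -- The boundary case k = n + 1, where natural subtraction truncates, is separate; otherwise
    -- Pascal's rule and (k+1)·C(j,k+1) = (j-k)·C(j,k), with j = n - k, suffice.
    rcases Nat.lt_or_ge n k with h | h
    · have : n - k = 0 := by omega
      have h' : n + 1 - k = 0 := by omega
      rw [this, h', Nat.choose_eq_zero_of_lt (by omega : 0 < k),
        Nat.choose_eq_zero_of_lt (by omega : 0 < k + 1)]
      simp
    · obtain ⟨j, rfl⟩ := Nat.exists_eq_add_of_le h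
      rw [show k + j + 1 - k = j + 1 by omega, show k + j - k = j by omega]
      have hc : ((j + 1).choose (k + 1) : ℝ) = j.choose k + j.choose (k + 1) := by
        exact_mod_cast Nat.choose_succ_succ j k
      have hc2 : (j.choose (k + 1) : ℝ) * (k + 1) = j.choose k * (j - k) := by
        rcases Nat.lt_or_ge j k with h | h
        · rw [Nat.choose_eq_zero_of_lt h, Nat.choose_eq_zero_of_lt (by omega : j < k + 1)]
          simp
        · have := Nat.choose_succ_right_eq j k
          rw [← Nat.cast_sub h]
          exact_mod_cast this
      rw [hc]
      generalize Real.Gamma (ν + 1 + ((k + j : ℕ) : ℝ) - k) = γ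
      push_cast
      field_simp
      linear_combination (-γ) * hc2
  · have hz : (x / 2) ^ (2 * ((0 : ℕ) : ℤ) - ((n + 1 : ℕ) : ℤ)) =
        (x / 2) ^ (2 * ((0 : ℕ) : ℤ) - ((n + 2 : ℕ) : ℤ)) * (x / 2) := by
      rw [← zpow_add_one₀ hy]; push_cast; ring_nf
    have e1 : ν + 1 + ((n + 1 : ℕ) : ℝ) = ν + ((n + 2 : ℕ) : ℝ) := by push_cast; ring
    rw [hz]
    simp only [e1, Nat.cast_zero, add_zero, hΓ, pow_zero, Nat.choose_zero_right]
    field_simp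

lemma lommelR_eq_lommelShift (n : ℕ) {ν x : ℝ} (hν : 0 < ν) (hx : 0 < x) :
    lommelR n ν x = lommelShift (n + 1) ν x := by
  induction n using Nat.twoStepInduction generalizing ν with
  | zero =>
    have := (Real.Gamma_pos_of_pos hν).ne'
    simp [lommelR, lommelShift, this]
  | one =>
    have := (Real.Gamma_pos_of_pos hν).ne'
    simp [lommelR, lommelShift, Real.Gamma_add_one hν.ne', this]
    field_simp
  | more n h0 h1 =>
    rw [lommelR_add_two n hν hx, h0 (by linarith), h1 (by linarith),
      show n + 2 + 1 = n + 1 + 2 from rfl, lommelShift_add_two (n + 1) ν]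

lemma lommelShift_determinant (n : ℕ) (ν x : ℝ) :
    lommelShift (n + 1) ν x * lommelShift (n + 1) (ν + 1) x -
      lommelShift (n + 2) ν x * lommelShift n (ν + 1) x = 1 := by
  induction n generalizing ν with
  | zero => simp [lommelShift]
  | succ n ih =>
    have h := ih (ν + 1)
    rw [lommelShift_add_two (n + 1) ν, lommelShift_add_two n ν, show n + 1 + 1 = n + 2 from rfl]
    rw [show ν + 1 + 1 = ν + 2 by ring] at h
    linear_combination h

lemma cylinderC_add_natCast_succ {α ν x : ℝ} (n : ℕ) (hν : 0 ≤ ν) (hx : 0 < x) :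
    cylinderC α (ν + (n + 1 : ℕ)) x = lommelShift (n + 1) (ν + 1) x * cylinderC α (ν + 1) x -
      lommelShift n (ν + 2) x * cylinderC α ν x := by
  induction n generalizing ν with
  | zero => simp [lommelShift]
  | succ n ih =>
    have h := ih (ν := ν + 1) (by linarith)
    have h2 := cylinderC_add_two (α := α) hν hx
    rw [show ν + 1 + ((n + 1 : ℕ) : ℝ) = ν + ((n + 1 + 1 : ℕ) : ℝ) by push_cast; ring,
      show ν + 1 + 1 = ν + 2 by ring] at h
    rw [h, lommelShift, show ν + 1 + 1 = ν + 2 by ring]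
    linear_combination lommelShift (n + 1) (ν + 2) x * h2

/-- This inverts the linear relations expressing C_{ν+n} and C_{ν+n+1} through C_ν and C_{ν+1};
their determinant is 1 by `lommelShift_determinant`. -/
lemma cylinderC_eq_of_add_natCast {α ν x : ℝ} (n : ℕ) (hν : 0 ≤ ν) (hx : 0 < x) :
    cylinderC α ν x = lommelShift (n + 1) (ν + 1) x * cylinderC α (ν + n) x -
      lommelShift n (ν + 1) x * cylinderC α (ν + (n + 1 : ℕ)) x := by
  cases n with
  | zero => simp [lommelShift]
  | succ n =>
    have h1 := cylinderC_add_natCast_succ (α := α) n hν hx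
    have h2 := cylinderC_add_natCast_succ (α := α) (n + 1) hν hx
    have h3 := lommelShift_determinant n (ν + 1) x
    rw [show ν + 1 + 1 = ν + 2 by ring] at h3
    rw [h1, h2]
    linear_combination -cylinderC α ν x * h3

lemma hasDerivAt_lommelShift_add_two {n : ℕ} {ν x : ℝ} (hx : x ≠ 0)
    (h0 : DifferentiableAt ℝ (lommelShift n (ν + 2)) x)
    (h1 : DifferentiableAt ℝ (lommelShift (n + 1) (ν + 1)) x) :
    HasDerivAt (lommelShift (n + 2) ν) (-(2 * ν / x ^ 2) * lommelShift (n + 1) (ν + 1) x +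
      2 * ν / x * deriv (lommelShift (n + 1) (ν + 1)) x - deriv (lommelShift n (ν + 2)) x) x := by
  have hi : HasDerivAt (fun x : ℝ => 2 * ν / x) (-(2 * ν / x ^ 2)) x := by
    refine ((hasDerivAt_inv hx).const_mul (2 * ν)).congr_deriv ?_
    ring
  exact (hi.mul h1.hasDerivAt).sub h0.hasDerivAt

lemma differentiableAt_lommelShift (n : ℕ) (ν : ℝ) {x : ℝ} (hx : x ≠ 0) :
    DifferentiableAt ℝ (lommelShift n ν) x := by
  induction n using Nat.twoStepInduction generalizing ν with
  | zero => exact differentiableAt_const 0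
  | one => exact differentiableAt_const 1
  | more n h0 h1 => exact (hasDerivAt_lommelShift_add_two hx (h0 _) (h1 _)).differentiableAt

/-- The quotient `R_{n+1,ν} / R_{n,ν+1}` has negative derivative. -/
lemma lommelShift_wronskian_neg (n : ℕ) {ν x : ℝ} (hν : 0 < ν) (hx : 0 < x) :
    deriv (lommelShift (n + 2) ν) x * lommelShift (n + 1) (ν + 1) x -
      lommelShift (n + 2) ν x * deriv (lommelShift (n + 1) (ν + 1)) x < 0 := by
  have hd : ∀ n ν, deriv (lommelShift (n + 2) ν) x = _ := fun n ν =>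
    (hasDerivAt_lommelShift_add_two hx.ne' (differentiableAt_lommelShift n (ν + 2) hx.ne')
      (differentiableAt_lommelShift (n + 1) (ν + 1) hx.ne')).deriv
  have hpos : 0 < 2 * ν / x ^ 2 := by positivity
  induction n generalizing ν with
  | zero =>
    have e0 : ∀ μ, lommelShift 0 μ = fun _ => 0 := fun μ => rfl
    have e1 : ∀ μ, lommelShift 1 μ = fun _ => 1 := fun μ => rfl
    rw [hd]
    simpa [e0, e1] using hpos
  | succ n ih =>
    have h := ih (ν := ν + 1) (by linarith) (by positivity)
    have hL : lommelShift (n + 1 + 2) ν x = 2 * ν / x * lommelShift (n + 2) (ν + 1) x -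
      lommelShift (n + 1) (ν + 2) x := rfl
    rw [hd (n + 1) ν, hL, show n + 1 + 1 = n + 2 from rfl]
    rw [show ν + 1 + 1 = ν + 2 by ring] at h
    -- By the recurrence this Wronskian is the one for n at order ν + 1 minus (2ν/x²) times a
    -- square.
    nlinarith [mul_nonneg hpos.le (sq_nonneg (lommelShift (n + 2) (ν + 1) x))]

lemma lommelShift_mul_eq_one {n : ℕ} {ν x : ℝ} (h : lommelShift (n + 1) ν x = 0) :
    lommelShift n ν x * lommelShift n (ν + 1) x = 1 := by
  cases n with
  | zero => simp [lommelShift] at h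
  | succ n =>
    have := lommelShift_determinant n ν x
    rwa [show n + 2 = n + 1 + 1 from rfl, h, zero_mul, sub_zero] at this

lemma deriv_lommelShift_mul_neg {n : ℕ} {ν x : ℝ} (hν : 0 < ν) (hx : 0 < x)
    (h : lommelShift (n + 1) ν x = 0) :
    deriv (lommelShift (n + 1) ν) x * lommelShift n (ν + 1) x < 0 := by
  cases n with
  | zero => simp [lommelShift] at h
  | succ n =>
    have := lommelShift_wronskian_neg n hν hx
    rwa [show n + 2 = n + 1 + 1 from rfl, h, zero_mul, sub_zero] at this

/-- The positive constant term gives both positivity near 0 and, the polynomial being nonzero,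
finiteness of the zeros. -/
lemma exists_polynomial_lommelShift (n : ℕ) {ν : ℝ} (hν : 0 < ν) :
    ∃ p : Polynomial ℝ, 0 < p.eval 0 ∧
      ∀ x : ℝ, x ≠ 0 → x ^ n * lommelShift (n + 1) ν x = p.eval x := by
  induction n using Nat.twoStepInduction generalizing ν with
  | zero => exact ⟨1, by simp, by simp [lommelShift]⟩
  | one =>
    refine ⟨Polynomial.C (2 * ν), by simpa using hν, fun x hx => ?_⟩
    simp only [lommelShift, Polynomial.eval_C]
    field_simp
    ring
  | more n h0 h1 =>
    obtain ⟨p, hp, hpx⟩ := h0 (ν := ν + 2) (by linarith)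
    obtain ⟨q, hq, hqx⟩ := h1 (ν := ν + 1) (by linarith)
    refine ⟨Polynomial.C (2 * ν) * q - Polynomial.X ^ 2 * p, ?_, fun x hx => ?_⟩
    · simpa using mul_pos (mul_pos two_pos hν) hq
    · simp only [Polynomial.eval_sub, Polynomial.eval_mul, Polynomial.eval_C, Polynomial.eval_pow,
        Polynomial.eval_X]
      rw [← hpx x hx, ← hqx x hx, lommelShift]
      field_simp
      ring

lemma eventually_lommelShift_pos (n : ℕ) {ν : ℝ} (hν : 0 < ν) :
    ∀ᶠ x in 𝓝[>] (0 : ℝ), 0 < lommelShift (n + 1) ν x := by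
  obtain ⟨p, hp, hpx⟩ := exists_polynomial_lommelShift n hν
  filter_upwards [nhdsWithin_le_nhds (p.continuous.continuousAt.eventually (lt_mem_nhds hp)),
    self_mem_nhdsWithin] with x hx hx0
  rw [Set.mem_Ioi] at hx0
  rw [← hpx x hx0.ne'] at hx
  exact pos_of_mul_pos_right hx (by positivity)

lemma exists_lommelShift_ne_zero (n : ℕ) {ν : ℝ} (hν : 0 < ν) :
    ∃ T : ℝ, ∀ x, T < x → 0 < x → lommelShift (n + 1) ν x ≠ 0 := by
  obtain ⟨p, hp, hpx⟩ := exists_polynomial_lommelShift n hν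
  have hp0 : p ≠ 0 := by rintro rfl; simp at hp
  obtain ⟨T, hT⟩ := (Polynomial.finite_setOfPred_isRoot hp0).bddAbove
  refine ⟨T, fun x hx hx0 h => hx.not_ge (hT ?_)⟩
  change p.eval x = 0
  rw [← hpx x hx0.ne', h, mul_zero]

/-! ### Sign changes and abstract interlacing. -/

/-- `f` is negative just before `x` and positive just after `x`. -/
def SignChangesUpAt (f : ℝ → ℝ) (x : ℝ) : Prop :=
  (∀ᶠ y in 𝓝[<] x, f y < 0) ∧ ∀ᶠ y in 𝓝[>] x, 0 < f y

lemma signChangesUpAt_of_mul {f g : ℝ → ℝ} {x : ℝ} (hg : ∀ᶠ y in 𝓝[≠] x, 0 < g y)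
    (hf : ∀ᶠ y in 𝓝[≠] x, f y = g y * (y - x)) : SignChangesUpAt f x := by
  constructor
  · filter_upwards [hg.filter_mono (nhdsLT_le_nhdsNE x), hf.filter_mono (nhdsLT_le_nhdsNE x),
      self_mem_nhdsWithin] with y h1 h2 h3
    rw [h2]
    exact mul_neg_of_pos_of_neg h1 (sub_neg.2 h3)
  · filter_upwards [hg.filter_mono (nhdsGT_le_nhdsNE x), hf.filter_mono (nhdsGT_le_nhdsNE x),
      self_mem_nhdsWithin] with y h1 h2 h3
    rw [h2]
    exact mul_pos h1 (sub_pos.2 h3)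

lemma eq_slope_mul {f : ℝ → ℝ} {x y : ℝ} (h0 : f x = 0) : f y = slope f x y * (y - x) := by
  have := sub_smul_slope f x y
  rw [smul_eq_mul, vsub_eq_sub, h0, sub_zero] at this
  rw [← this, mul_comm]

lemma signChangesUpAt_of_hasDerivAt {f : ℝ → ℝ} {f' x : ℝ} (hf : HasDerivAt f f' x)
    (h0 : f x = 0) (hf' : 0 < f') : SignChangesUpAt f x :=
  signChangesUpAt_of_mul ((hasDerivAt_iff_tendsto_slope.1 hf).eventually (lt_mem_nhds hf'))
    (Filter.Eventually.of_forall fun _ => eq_slope_mul h0)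

/-- The product is (y - x)³ times three slopes, whose product tends to f'g'h' > 0. -/
lemma signChangesUpAt_mul_mul {f g h : ℝ → ℝ} {f' g' h' x : ℝ} (hf : HasDerivAt f f' x)
    (hg : HasDerivAt g g' x) (hh : HasDerivAt h h' x) (hf0 : f x = 0) (hg0 : g x = 0)
    (hh0 : h x = 0) (hpos : 0 < f' * g' * h') :
    SignChangesUpAt (fun y => f y * g y * h y) x := by
  have ht := ((hasDerivAt_iff_tendsto_slope.1 hf).mul (hasDerivAt_iff_tendsto_slope.1 hg)).mul
    (hasDerivAt_iff_tendsto_slope.1 hh)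
  refine signChangesUpAt_of_mul (g := fun y => slope f x y * slope g x y * slope h x y *
    (y - x) ^ 2) ?_ (Filter.Eventually.of_forall fun y => ?_)
  · filter_upwards [ht.eventually (lt_mem_nhds hpos), self_mem_nhdsWithin] with y h1 h2
    exact mul_pos h1 (sq_pos_of_ne_zero (sub_ne_zero.2 h2))
  · rw [eq_slope_mul (y := y) hf0, eq_slope_mul (y := y) hg0, eq_slope_mul (y := y) hh0]
    ring

lemma exists_next_zero {f : ℝ → ℝ} {x : ℝ} (hf : ContinuousOn f (Set.Ioi x))
    (hpos : ∀ᶠ y in 𝓝[>] x, 0 < f y) (hz : ∃ z, x < z ∧ f z = 0) :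
    ∃ z, x < z ∧ f z = 0 ∧ ∀ y ∈ Set.Ioo x z, 0 < f y := by
  obtain ⟨δ, hδ, hδf⟩ := mem_nhdsGT_iff_exists_Ioo_subset.1 hpos
  obtain ⟨w, hxw, hw⟩ := hz
  obtain ⟨a, hxa, haw⟩ := exists_between (lt_min hδ hxw)
  have haδ := haw.trans_le (min_le_left _ _)
  have haw := haw.trans_le (min_le_right _ _)
  have hsub : Set.Icc a w ⊆ Set.Ioi x := fun y hy => hxa.trans_le hy.1
  have hK : IsCompact (Set.Icc a w ∩ f ⁻¹' {0}) :=
    isCompact_Icc.of_isClosed_subset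
      ((hf.mono hsub).preimage_isClosed_of_isClosed isClosed_Icc isClosed_singleton)
      Set.inter_subset_left
  obtain ⟨z, ⟨⟨haz, hzw⟩, hz0⟩, hmin⟩ := hK.exists_isLeast ⟨w, ⟨haw.le, le_rfl⟩, hw⟩
  refine ⟨z, hxa.trans_le haz, hz0, fun y hy => ?_⟩
  rcases lt_or_ge y δ with hyδ | hyδ
  · exact hδf ⟨hy.1, hyδ⟩
  · by_contra! hneg
    have hay : a ≤ y := haδ.le.trans hyδ
    have hc : ContinuousOn f (Set.Icc a y) :=
      hf.mono fun u hu => hxa.trans_le hu.1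
    obtain ⟨u, hu, hu0⟩ := intermediate_value_Icc' hay hc ⟨hneg, le_of_lt (hδf ⟨hxa, haδ⟩)⟩
    exact (hu.2.trans_lt hy.2).not_ge (hmin ⟨⟨hu.1, (hu.2.trans hy.2.le).trans hzw⟩, hu0⟩)

/-- If a continuous function on `(0, ∞)` is positive near `0`, and its zeros are the points of `A`,
where it changes sign downwards, and those of `B`, where it changes sign upwards, then `A` and `B`
interlace. -/
theorem exists_interlacing_enumerations {f : ℝ → ℝ} {A B : Set ℝ}
    (hf : ContinuousOn f (Set.Ioi 0)) (hzero : ∀ x, 0 < x → f x = 0 → x ∈ A ∪ B)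
    (hA : ∀ x ∈ A, 0 < x ∧ f x = 0 ∧ SignChangesUpAt (-f) x)
    (hB : ∀ x ∈ B, 0 < x ∧ f x = 0 ∧ SignChangesUpAt f x)
    (h0 : ∀ᶠ x in 𝓝[>] (0 : ℝ), 0 < f x) (hunb : ∀ T, ∃ a ∈ A, T < a) :
    ∃ c τ : ℕ → ℝ, IsAscendingEnumeration A c ∧ IsAscendingEnumeration B τ ∧
      0 < c 0 ∧ ∀ k : ℕ, c k < τ k ∧ τ k < c (k + 1) := by
  have hdisj : ∀ x ∈ A, x ∉ B := fun x hxA hxB => by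
    obtain ⟨y, h1, h2⟩ := ((hA x hxA).2.2.2.and (hB x hxB).2.2.2).exists
    rw [Pi.neg_apply] at h1
    linarith
  -- After 0 or a point of B, f stays positive up to its next zero, which therefore cannot be an
  -- upward change and lies in A.
  have hstepA : ∀ x, x = 0 ∨ x ∈ B → ∃ z ∈ A, x < z ∧ ∀ y ∈ Set.Ioo x z, f y ≠ 0 := by
    intro x hx
    obtain ⟨hx0, hup⟩ : 0 ≤ x ∧ ∀ᶠ y in 𝓝[>] x, 0 < f y := by
      rcases hx with rfl | hx
      · exact ⟨le_rfl, h0⟩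
      · exact ⟨(hB x hx).1.le, (hB x hx).2.2.2⟩
    obtain ⟨a, haA, hxa⟩ := hunb x
    obtain ⟨z, hxz, hz, hlt⟩ := exists_next_zero (hf.mono (Set.Ioi_subset_Ioi hx0)) hup
      ⟨a, hxa, (hA a haA).2.1⟩
    refine ⟨z, (hzero z (hx0.trans_lt hxz) hz).resolve_right fun hzB => ?_, hxz,
      fun y hy => (hlt y hy).ne'⟩
    obtain ⟨y, h1, h2⟩ := ((hB z hzB).2.2.1.and (Ioo_mem_nhdsLT hxz)).exists
    exact (hlt y h2).not_gt h1
  have hstepB : ∀ x, x ∈ A → ∃ z ∈ B, x < z ∧ ∀ y ∈ Set.Ioo x z, f y ≠ 0 := by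
    intro x hx
    obtain ⟨hx0, -, -, hup⟩ := hA x hx
    obtain ⟨a, haA, hxa⟩ := hunb x
    obtain ⟨z, hxz, hz, hlt⟩ := exists_next_zero (f := -f)
      (hf.neg.mono (Set.Ioi_subset_Ioi hx0.le)) hup ⟨a, hxa, by simpa using (hA a haA).2.1⟩
    refine ⟨z, (hzero z (hx0.trans hxz) (by simpa using hz)).resolve_left fun hzA => ?_, hxz,
      fun y hy => by simpa using (hlt y hy).ne'⟩
    obtain ⟨y, h1, h2⟩ := ((hA z hzA).2.2.1.and (Ioo_mem_nhdsLT hxz)).exists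
    exact (hlt y h2).not_gt h1
  choose! F hFA hFlt hFne using hstepA
  choose! G hGB hGlt hGne using hstepB
  let c : ℕ → ℝ := fun k => (F ∘ G)^[k] (F 0)
  have hsucc : ∀ k, c (k + 1) = F (G (c k)) := fun k => Function.iterate_succ_apply' _ _ _
  have hcA : ∀ k, c k ∈ A := by
    intro k
    induction k with
    | zero => exact hFA 0 (Or.inl rfl)
    | succ k ih => rw [hsucc]; exact hFA _ (Or.inr (hGB _ ih))
  have hτB : ∀ k, G (c k) ∈ B := fun k => hGB _ (hcA k)
  have hcτ : ∀ k, c k < G (c k) := fun k => hGlt _ (hcA k)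
  have hτc : ∀ k, G (c k) < c (k + 1) := fun k => by rw [hsucc]; exact hFlt _ (Or.inr (hτB k))
  have hcmono : StrictMono c := strictMono_nat_of_lt_succ fun k => (hcτ k).trans (hτc k)
  have hτmono : StrictMono fun k => G (c k) :=
    strictMono_nat_of_lt_succ fun k => (hτc k).trans (hcτ (k + 1))
  -- If c stayed bounded, its limit L would be a zero of f, yet f has a strict sign just left of L,
  -- where the zeros c k accumulate.
  have hexceed : ∀ z, 0 < z → f z = 0 → ∃ k, z ≤ c k := by
    intro z hz0 hz
    by_contra! hlt
    have hbdd : BddAbove (Set.range c) := ⟨z, by rintro _ ⟨k, rfl⟩; exact (hlt k).le⟩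
    have hlim := tendsto_atTop_ciSup hcmono.monotone hbdd
    have hcL : ∀ k, c k < ⨆ i, c i := fun k =>
      (hcmono k.lt_succ_self).trans_le (le_ciSup hbdd (k + 1))
    generalize (⨆ i, c i) = L at hlim hcL
    have hL0 : 0 < L := (hA _ (hcA 0)).1.trans (hcL 0)
    have hfL : f L = 0 := by
      have h1 := ((hf.continuousAt (Ioi_mem_nhds hL0)).tendsto.comp hlim)
      refine tendsto_nhds_unique h1 (tendsto_const_nhds.congr fun k => ?_)
      exact ((hA _ (hcA k)).2.1).symm
    have hne : ∀ᶠ y in 𝓝[<] L, f y ≠ 0 := by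
      rcases hzero L hL0 hfL with h | h
      · filter_upwards [(hA L h).2.2.1] with y hy using by simpa using hy.ne
      · filter_upwards [(hB L h).2.2.1] with y hy using hy.ne
    have hlim' : Filter.Tendsto c Filter.atTop (𝓝[<] L) :=
      tendsto_nhdsWithin_iff.2 ⟨hlim, Filter.Eventually.of_forall hcL⟩
    obtain ⟨k, hk⟩ := (hlim'.eventually hne).exists
    exact hk (hA _ (hcA k)).2.1
  have hcover : ∀ z, 0 < z → f z = 0 → (∃ k, c k = z) ∨ ∃ k, G (c k) = z := by
    intro z hz0 hz
    classical
    have hex := hexceed z hz0 hz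
    obtain ⟨k, hk, hkmin⟩ : ∃ k, z ≤ c k ∧ ∀ j < k, c j < z :=
      ⟨Nat.find hex, Nat.find_spec hex, fun j hj => not_le.1 (Nat.find_min hex hj)⟩
    rcases hk.eq_or_lt with hk | hk
    · exact Or.inl ⟨k, hk.symm⟩
    · cases k with
      | zero => exact absurd hz (hFne 0 (Or.inl rfl) z ⟨hz0, hk⟩)
      | succ j =>
        have hj := hkmin j j.lt_succ_self
        rcases lt_trichotomy z (G (c j)) with h | h | h
        · exact absurd hz (hGne _ (hcA j) z ⟨hj, h⟩)
        · exact Or.inr ⟨j, h.symm⟩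
        · rw [hsucc] at hk
          exact absurd hz (hFne _ (Or.inr (hτB j)) z ⟨h, hk⟩)
  refine ⟨c, fun k => G (c k), ⟨hcmono, Set.Subset.antisymm ?_ fun z hz => ?_⟩,
    ⟨hτmono, Set.Subset.antisymm ?_ fun z hz => ?_⟩, (hA _ (hcA 0)).1, fun k => ⟨hcτ k, hτc k⟩⟩
  · rintro _ ⟨k, rfl⟩; exact hcA k
  · refine (hcover z (hA z hz).1 (hA z hz).2.1).resolve_right ?_
    rintro ⟨k, rfl⟩
    exact hdisj _ hz (hτB k)
  · rintro _ ⟨k, rfl⟩; exact hτB k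
  · refine (hcover z (hB z hz).1 (hB z hz).2.1).resolve_left ?_
    rintro ⟨k, rfl⟩
    exact hdisj _ (hcA k) hz

/-! ### Sign changes of the product R_{m-1,ν+1} · C_{ν+m} · C_ν, with m = n + 1. -/

section SignChanges

variable {α ν x : ℝ} {n : ℕ}

lemma hasDerivAt_lommelShift_mul_cylinderC (hν : 0 < ν) (hx : 0 < x) :
    HasDerivAt (fun x => lommelShift (n + 1) (ν + 1) x * cylinderC α (ν + (n + 1 : ℕ)) x *
        cylinderC α ν x)
      ((deriv (lommelShift (n + 1) (ν + 1)) x * cylinderC α (ν + (n + 1 : ℕ)) x +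
        lommelShift (n + 1) (ν + 1) x * (cylinderC α (ν + n) x -
          (ν + n + 1) / x * cylinderC α (ν + (n + 1 : ℕ)) x)) * cylinderC α ν x +
        lommelShift (n + 1) (ν + 1) x * cylinderC α (ν + (n + 1 : ℕ)) x *
          (-cylinderC α (ν + 1) x + ν / x * cylinderC α ν x)) x := by
  have hm := hasDerivAt_cylinderC_add_one (α := α) (ν := ν + n) (by positivity) hx
  rw [show ν + n + 1 = ν + ((n + 1 : ℕ) : ℝ) by push_cast; ring] at hm ⊢
  exact ((differentiableAt_lommelShift (n + 1) (ν + 1) hx.ne').hasDerivAt.mul hm).mul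
    (hasDerivAt_cylinderC hν.le hx)

lemma signChangesUpAt_neg_of_cylinderC (hν : 0 < ν) (hx : 0 < x) (h : cylinderC α ν x = 0)
    (hm : cylinderC α (ν + (n + 1 : ℕ)) x ≠ 0) :
    SignChangesUpAt (-fun x => lommelShift (n + 1) (ν + 1) x *
      cylinderC α (ν + (n + 1 : ℕ)) x * cylinderC α ν x) x := by
  have hE := cylinderC_add_natCast_succ (α := α) n hν.le hx
  rw [h, mul_zero, sub_zero] at hE
  refine signChangesUpAt_of_hasDerivAt (hasDerivAt_lommelShift_mul_cylinderC hν hx).neg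
    (by simp [h]) ?_
  have := sq_pos_of_ne_zero hm
  rw [hE] at this
  rw [h, hE]
  linarith

lemma signChangesUpAt_of_common_zero (hν : 0 < ν) (hx : 0 < x) (h : cylinderC α ν x = 0)
    (hm : cylinderC α (ν + (n + 1 : ℕ)) x = 0) :
    SignChangesUpAt (fun x => lommelShift (n + 1) (ν + 1) x *
      cylinderC α (ν + (n + 1 : ℕ)) x * cylinderC α ν x) x := by
  have h1 := cylinderC_add_one_ne_zero hν.le hx h
  have hE := cylinderC_add_natCast_succ (α := α) n hν.le hx
  rw [h, hm, mul_zero, sub_zero, eq_comm, mul_eq_zero, or_iff_left h1] at hE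
  have hdn := hasDerivAt_cylinderC_add_one (α := α) (ν := ν + n) (by positivity) hx
  rw [show ν + n + 1 = ν + ((n + 1 : ℕ) : ℝ) by push_cast; ring, hm, mul_zero, sub_zero] at hdn
  have hd0 := hasDerivAt_cylinderC (α := α) hν.le hx
  rw [h, mul_zero, add_zero] at hd0
  refine signChangesUpAt_mul_mul (differentiableAt_lommelShift (n + 1) (ν + 1) hx.ne').hasDerivAt
    hdn hd0 hE hm h ?_
  have hn : cylinderC α (ν + n) x = lommelShift n (ν + 1) x * cylinderC α (ν + 1) x := by
    cases n with
    | zero => simpa [lommelShift] using h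
    | succ n =>
      rw [cylinderC_add_natCast_succ n hν.le hx, h, mul_zero, sub_zero]
  have hneg := deriv_lommelShift_mul_neg (by linarith : 0 < ν + 1) hx hE
  have hone := lommelShift_mul_eq_one hE
  rw [hn]
  -- The Wronskian gives this sign with order ν + 2 in the second factor; the two values have
  -- product 1, hence the same sign.
  have hsign : deriv (lommelShift (n + 1) (ν + 1)) x * lommelShift n (ν + 1) x < 0 := by
    have h2 : 0 < lommelShift n (ν + 1) x ^ 2 :=
      sq_pos_of_ne_zero (fun h => by simp [h] at hone)
    have : deriv (lommelShift (n + 1) (ν + 1)) x * lommelShift n (ν + 1) x =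
        deriv (lommelShift (n + 1) (ν + 1)) x * lommelShift n (ν + 1 + 1) x *
          lommelShift n (ν + 1) x ^ 2 := by
      linear_combination (-deriv (lommelShift (n + 1) (ν + 1)) x * lommelShift n (ν + 1) x) * hone
    rw [this]
    exact mul_neg_of_neg_of_pos hneg h2
  have h3 : 0 < cylinderC α (ν + 1) x ^ 2 := sq_pos_of_ne_zero h1
  nlinarith [mul_pos_of_neg_of_neg hsign (neg_neg_of_pos h3)]

lemma signChangesUpAt_of_cylinderC_add (hν : 0 < ν) (hx : 0 < x)
    (hm : cylinderC α (ν + (n + 1 : ℕ)) x = 0) :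
    SignChangesUpAt (fun x => lommelShift (n + 1) (ν + 1) x *
      cylinderC α (ν + (n + 1 : ℕ)) x * cylinderC α ν x) x := by
  by_cases h : cylinderC α ν x = 0
  · exact signChangesUpAt_of_common_zero hν hx h hm
  · have hE := cylinderC_eq_of_add_natCast (α := α) n hν.le hx
    rw [hm, mul_zero, sub_zero] at hE
    refine signChangesUpAt_of_hasDerivAt (hasDerivAt_lommelShift_mul_cylinderC hν hx)
      (by simp only [hm, mul_zero, zero_mul]) ?_
    rw [hm]
    have := sq_pos_of_ne_zero h
    rw [pow_two] at this
    nth_rewrite 1 [hE] at this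
    linarith

lemma signChangesUpAt_of_lommelShift (hν : 0 < ν) (hx : 0 < x)
    (hR : lommelShift (n + 1) (ν + 1) x = 0) :
    SignChangesUpAt (fun x => lommelShift (n + 1) (ν + 1) x *
      cylinderC α (ν + (n + 1 : ℕ)) x * cylinderC α ν x) x := by
  have hE := cylinderC_add_natCast_succ (α := α) n hν.le hx
  rw [hR, zero_mul, zero_sub] at hE
  by_cases h : cylinderC α ν x = 0
  · exact signChangesUpAt_of_common_zero hν hx h (by rw [hE, h, mul_zero, neg_zero])
  · refine signChangesUpAt_of_hasDerivAt (hasDerivAt_lommelShift_mul_cylinderC hν hx)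
      (by simp [hR]) ?_
    have hneg := deriv_lommelShift_mul_neg (by linarith : 0 < ν + 1) hx hR
    rw [show ν + 1 + 1 = ν + 2 by ring] at hneg
    rw [hR, hE]
    have := sq_pos_of_ne_zero h
    nlinarith [mul_pos_of_neg_of_neg hneg (neg_neg_of_pos this)]

end SignChanges

theorem theorem4p2 (α ν : ℝ) (m : ℕ) (hα₀ : 0 ≤ α) (hα₁ : α < Real.pi) (hν : 0 < ν)
    (hm : 1 ≤ m) :
    ∃ c τ : ℕ → ℝ,
      IsAscendingEnumeration (posZeros (cylinderC α ν) \ commonZeros α m ν) c ∧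
      IsAscendingEnumeration
        (posZeros (cylinderC α (ν + m)) ∪ posZeros (lommelR (m - 1) (ν + 1))) τ ∧
      0 < c 0 ∧ ∀ k : ℕ, c k < τ k ∧ τ k < c (k + 1) := by
  obtain ⟨n, rfl⟩ := Nat.exists_eq_add_of_le' hm
  rw [Nat.add_sub_cancel]
  have hν1 : 0 < ν + 1 := by linarith
  refine exists_interlacing_enumerations (f := fun x => lommelShift (n + 1) (ν + 1) x *
    cylinderC α (ν + (n + 1 : ℕ)) x * cylinderC α ν x) ?_ ?_ ?_ ?_ ?_ ?_
  · exact fun x hx =>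
      (hasDerivAt_lommelShift_mul_cylinderC hν hx).continuousAt.continuousWithinAt
  · intro x hx h
    by_cases hC : cylinderC α (ν + (n + 1 : ℕ)) x = 0
    · exact Or.inr (Or.inl ⟨hx, hC⟩)
    · rcases mul_eq_zero.1 h with h | h
      · rcases mul_eq_zero.1 h with h | h
        · exact Or.inr (Or.inr ⟨hx, by rw [lommelR_eq_lommelShift n hν1 hx, h]⟩)
        · exact absurd h hC
      · exact Or.inl ⟨⟨hx, h⟩, fun h' => hC h'.2⟩
  · rintro x ⟨⟨hx, h⟩, hM⟩
    exact ⟨hx, by simp [h], signChangesUpAt_neg_of_cylinderC hν hx h fun h' => hM ⟨⟨hx, h⟩, h'⟩⟩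
  · rintro x (⟨hx, h⟩ | ⟨hx, h⟩)
    · exact ⟨hx, by simp only [h, mul_zero, zero_mul], signChangesUpAt_of_cylinderC_add hν hx h⟩
    · rw [lommelR_eq_lommelShift n hν1 hx] at h
      exact ⟨hx, by simp [h], signChangesUpAt_of_lommelShift hν hx h⟩
  · filter_upwards [eventually_lommelShift_pos n hν1, eventually_cylinderC_pos hα₀ hα₁ hν,
      eventually_cylinderC_pos hα₀ hα₁ (by positivity : 0 < ν + ((n + 1 : ℕ) : ℝ))]
      with x h1 h2 h3
    positivity
  · intro T
    obtain ⟨S, hS⟩ := exists_lommelShift_ne_zero n hν1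
    obtain ⟨x, hTx, hx, h⟩ := exists_cylinderC_eq_zero (α := α) hν.le (max T S)
    -- Past every zero of R_{m-1,ν+1}, a zero of C_ν cannot be common: C_{ν+m} = R_{m-1,ν+1} C_{ν+1}
    -- ≠ 0 there.
    refine ⟨x, ⟨⟨hx, h⟩, fun hM => ?_⟩, (le_max_left _ _).trans_lt hTx⟩
    have hE := cylinderC_add_natCast_succ (α := α) n hν.le hx
    rw [hM.2, h, mul_zero, sub_zero, eq_comm, mul_eq_zero] at hE
    exact hE.elim (hS x ((le_max_right _ _).trans_lt hTx) hx)
      (cylinderC_add_one_ne_zero hν.le hx h)
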